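/- Let $f:(0,\infty)\to[0,\infty)$. (1) Suppose $f$ is bounded. Put $w_k=f(k)$ and $W_n=\sum_{k=1}^n w_k$, and assume $W_n\to\infty$. If $X_1,X_2,\dots$ are i.i.d. exponential random variables with mean $1$, then the weighted strong law of large numbers holds: $$\frac1{W_n}\sum_{k=1}^n w_kX_k\longrightarrow 1\quad\text{almost surely as } n\to\infty .$$ (2) Suppose $f$ is monotone: either nonincreasing, or nondecreasing and bounded. Assume that $f$ is integrable on $(0,t]$ for every $t>0$ and that $\lambda_tf=\int_0^t f(x)\,dx\to\infty$ as $t\to\infty$. Let $(\Gamma_t)_{t\ge0}$ be a standard Gamma process, that is, $\Gamma_0=0$, the paths are nondecreasing and right-continuous, the increments are independent, and $\Gamma_t-\Gamma_s$ has the Gamma distribution with shape $t-s$ and rate $1$ for $s<t$ (so $\Gamma_1$ is exponential with mean $1$). Let $\Gamma_tf=\int_{(0,t]}f\,d\Gamma$ be the pathwise Lebesgue-Stieltjes integral. Then almost surely $\Gamma_tf$ is finite for all $t$, and $$R_t=\frac{\Gamma_tf}{\lambda_tf}\longrightarrow 1\quad\text{almost surely as } t\to\infty ;$$ also $R_t\to1$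 in probability (orderly divergence). -/

import Mathlib

open Set Filter Topology MeasureTheory ProbabilityTheory
open scoped NNReal ENNReal

/-- The standard Gamma process on `[0, ∞)`: it starts at `0`, its paths are nondecreasing and
right-continuous, its increments are independent, and `Γ t - Γ s` has the Gamma distribution with
shape `t - s` and rate `1` for `s < t` (so `Γ 1` is exponential with mean `1`). -/
structure IsGammaProcess {Ω : Type*} [MeasurableSpace Ω] (Γ : ℝ≥0 → Ω → ℝ)
    (μ : Measure Ω) : Prop where
  measurable : ∀ t, Measurable (Γ t)
  zero : ∀ ω, Γ 0 ω = 0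
  mono : ∀ ω, Monotone (fun t => Γ t ω)
  rightCts : ∀ ω t, ContinuousWithinAt (fun s => Γ s ω) (Ici t) t
  indep : HasIndepIncrements Γ μ
  law : ∀ s t : ℝ≥0, s < t →
    HasLaw (fun ω => Γ t ω - Γ s ω) (gammaMeasure ((t : ℝ) - (s : ℝ)) 1) μ

namespace IsGammaProcess

variable {Ω : Type*} [MeasurableSpace Ω] {Γ : ℝ≥0 → Ω → ℝ} {μ : Measure Ω}

/-- A path of the process, extended by the value `Γ 0 = 0` to the negative half-line. -/
def path (h : IsGammaProcess Γ μ) (ω : Ω) : StieltjesFunction ℝ where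
  toFun x := Γ x.toNNReal ω
  mono' := fun _ _ hxy => h.mono ω (Real.toNNReal_le_toNNReal hxy)
  right_continuous' := fun x =>
    (h.rightCts ω x.toNNReal).comp continuous_real_toNNReal.continuousWithinAt
      (fun _ hy => Real.toNNReal_le_toNNReal hy)

/-- The random measure `dΓ(ω)`: it gives `(s, t]` the mass `Γ t ω - Γ s ω`. -/
noncomputable def pathMeasure (h : IsGammaProcess Γ μ) (ω : Ω) : Measure ℝ :=
  (h.path ω).measure

/-- The pathwise Gamma integral `Γ_t f = ∫_(0,t] f dΓ`. -/
noncomputable def gammaIntegral (h : IsGammaProcess Γ μ) (f : ℝ → ℝ) (t : ℝ) (ω : Ω) : ℝ :=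
  ∫ x in Ioc 0 t, f x ∂(h.pathMeasure ω)

end IsGammaProcess

/-- `λ_t f = ∫_0^t f(x) dx`. -/
noncomputable def lam (f : ℝ → ℝ) (t : ℝ) : ℝ := ∫ x in Ioc 0 t, f x

/-- The ratio `R_t = Γ_t f / λ_t f`. -/
noncomputable def IsGammaProcess.ratio {Ω : Type*} [MeasurableSpace Ω] {Γ : ℝ≥0 → Ω → ℝ}
    {μ : Measure Ω} (h : IsGammaProcess Γ μ) (f : ℝ → ℝ) (t : ℝ) (ω : Ω) : ℝ :=
  h.gammaIntegral f t ω / lam f t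

/-- Orderly divergence: `R_t → 1` in probability as `t → ∞`. -/
def OrderlyDivergence {Ω : Type*} [MeasurableSpace Ω] {Γ : ℝ≥0 → Ω → ℝ}
    {μ : Measure Ω} (h : IsGammaProcess Γ μ) (f : ℝ → ℝ) : Prop :=
  TendstoInMeasure μ (fun t : ℝ => h.ratio f t) atTop (fun _ => (1 : ℝ))

/-- Orderly divergence in the almost sure mode: almost surely all the integrals `Γ_t f` are
finite, and `R_t → 1` as `t → ∞`. -/
def OrderlyDivergenceAS {Ω : Type*} [MeasurableSpace Ω] {Γ : ℝ≥0 → Ω → ℝ}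
    {μ : Measure Ω} (h : IsGammaProcess Γ μ) (f : ℝ → ℝ) : Prop :=
  ∀ᵐ ω ∂μ, (∀ t : ℝ, IntegrableOn f (Ioc 0 t) (h.pathMeasure ω)) ∧
    Tendsto (fun t : ℝ => h.ratio f t ω) atTop (𝓝 1)

/-- The weights `w_k = f(k)`, `k ≥ 1`; the `k`-th weight is stored at index `k - 1`. -/
def sampledWeights (f : ℝ → ℝ) (k : ℕ) : ℝ := f ((k : ℝ) + 1)

/-- `W_n = w_1 + ⋯ + w_n`, with `w_k` stored at index `k - 1`. -/
noncomputable def totalWeight (w : ℕ → ℝ) (n : ℕ) : ℝ := ∑ k ∈ Finset.range n, w k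

/-- The weighted discrete strong law `(w_1 X_1 + ⋯ + w_n X_n) / W_n → 1` almost surely,
with `w_k` and `X_k` stored at index `k - 1`. -/
def WeightedDiscreteSLLN {Ω : Type*} [MeasurableSpace Ω] (μ : Measure Ω)
    (w : ℕ → ℝ) (X : ℕ → Ω → ℝ) : Prop :=
  ∀ᵐ ω ∂μ, Tendsto (fun n : ℕ => (∑ k ∈ Finset.range n, w k * X k ω) / totalWeight w n)
    atTop (𝓝 1)

/-!
The engine is the second-moment method for a family `S t` which is almost surely monotone and has
`Var (S t) ≤ C * E (S t)`. Along times at which the mean is `j² + O(1)`, Chebyshev's bounds are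
summable, so `S / E S → 1` there; as consecutive means along these times have ratio tending to `1`,
monotonicity carries the limit over to all times. For weighted sums with bounded weights this is
the discrete law.

For the Gamma process, the random measure `dΓ` has the same first two moments as a Poisson random
measure of intensity `dx`: `E (Γ_t f) = λ_t f` and `Var (Γ_t f) = λ_t (f²) ≤ M * λ_t f` when
`0 ≤ f ≤ M`. Only independence and the Gamma law of the increments enter, through the values of the
moments on half-lines. An unbounded part of `f` near `0` contributes only a finite constant to
`Γ_t f` and to `λ_t f`, which is negligible since `λ_t f → ∞`.
-/

section NonnegMoments

variable {Ω : Type*} [MeasurableSpace Ω] {μ : Measure Ω} {X : Ω → ℝ} {m q : ℝ}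

lemma integral_eq_of_lintegral_ofReal (hX : AEMeasurable X μ) (hX₀ : 0 ≤ᵐ[μ] X) (hm : 0 ≤ m)
    (h : ∫⁻ ω, ENNReal.ofReal (X ω) ∂μ = ENNReal.ofReal m) : μ[X] = m := by
  rw [integral_eq_lintegral_of_nonneg_ae hX₀ hX.aestronglyMeasurable, h, ENNReal.toReal_ofReal hm]

lemma memLp_two_of_lintegral_ofReal_sq_ne_top (hX : AEMeasurable X μ) (hX₀ : 0 ≤ᵐ[μ] X)
    (h : ∫⁻ ω, ENNReal.ofReal (X ω) ^ 2 ∂μ ≠ ∞) : MemLp X 2 μ := by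
  refine (memLp_two_iff_integrable_sq hX.aestronglyMeasurable).2
    ⟨(hX.pow_const 2).aestronglyMeasurable, ?_⟩
  rw [hasFiniteIntegral_iff_ofReal (ae_of_all _ fun ω => sq_nonneg (X ω)), lt_top_iff_ne_top]
  convert h using 1
  exact lintegral_congr_ae (hX₀.mono fun ω hω => ENNReal.ofReal_pow hω 2)

lemma variance_eq_of_lintegral_ofReal [IsProbabilityMeasure μ] (hX : AEMeasurable X μ)
    (hX₀ : 0 ≤ᵐ[μ] X) (hm : 0 ≤ m) (hq : 0 ≤ q)
    (h : ∫⁻ ω, ENNReal.ofReal (X ω) ∂μ = ENNReal.ofReal m)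
    (hsq : ∫⁻ ω, ENNReal.ofReal (X ω) ^ 2 ∂μ = ENNReal.ofReal q) : Var[X; μ] = q - m ^ 2 := by
  have hmem := memLp_two_of_lintegral_ofReal_sq_ne_top hX hX₀ (hsq ▸ ENNReal.ofReal_ne_top)
  have hmean_sq : μ[X ^ 2] = q := by
    refine integral_eq_of_lintegral_ofReal (hX.pow_const 2) (ae_of_all _ fun ω => sq_nonneg _) hq ?_
    rw [← hsq]
    exact lintegral_congr_ae (hX₀.mono fun ω hω => ENNReal.ofReal_pow hω 2)
  rw [variance_eq_sub hmem, hmean_sq, integral_eq_of_lintegral_ofReal hX hX₀ hm h]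

end NonnegMoments

section GammaMoments

variable {a r : ℝ}

lemma ofReal_mul_gammaPDF (ha : 0 < a) (hr : 0 < r) (x : ℝ) :
    ENNReal.ofReal x * gammaPDF a r x = ENNReal.ofReal (a / r) * gammaPDF (a + 1) r x := by
  rcases lt_or_ge x 0 with hx | hx
  · simp [gammaPDF_of_neg hx]
  · rw [gammaPDF_of_nonneg hx, gammaPDF_of_nonneg hx, ← ENNReal.ofReal_mul hx,
      ← ENNReal.ofReal_mul (by positivity)]
    congr 1
    have hΓ := (Real.Gamma_pos_of_pos ha).ne'
    rw [Real.Gamma_add_one ha.ne', add_sub_cancel_right, Real.rpow_add_one hr.ne']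
    rcases hx.eq_or_lt with rfl | hx
    · simp [Real.zero_rpow ha.ne']
    · rw [Real.rpow_sub_one hx.ne']
      field_simp

lemma lintegral_ofReal_mul_gammaMeasure (ha : 0 < a) (hr : 0 < r) {g : ℝ → ℝ≥0∞}
    (hg : Measurable g) :
    ∫⁻ x, ENNReal.ofReal x * g x ∂(gammaMeasure a r)
      = ENNReal.ofReal (a / r) * ∫⁻ x, g x ∂(gammaMeasure (a + 1) r) := by
  have hpdf (b : ℝ) : Measurable (gammaPDF b r) := (measurable_gammaPDFReal b r).ennreal_ofReal
  rw [gammaMeasure, gammaMeasure, lintegral_withDensity_eq_lintegral_mul _ (hpdf a) (by fun_prop),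
    lintegral_withDensity_eq_lintegral_mul _ (hpdf _) hg,
    ← lintegral_const_mul _ ((hpdf _).mul hg)]
  refine lintegral_congr fun x => ?_
  simp only [Pi.mul_apply]
  rw [← mul_assoc, mul_comm (gammaPDF a r x), ofReal_mul_gammaPDF ha hr, mul_assoc]

lemma lintegral_ofReal_gammaMeasure (ha : 0 < a) (hr : 0 < r) :
    ∫⁻ x, ENNReal.ofReal x ∂(gammaMeasure a r) = ENNReal.ofReal (a / r) := by
  have := isProbabilityMeasure_gammaMeasure (add_pos ha one_pos) hr
  simpa using lintegral_ofReal_mul_gammaMeasure ha hr (measurable_const (a := (1 : ℝ≥0∞)))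

lemma lintegral_ofReal_sq_gammaMeasure (ha : 0 < a) (hr : 0 < r) :
    ∫⁻ x, ENNReal.ofReal x ^ 2 ∂(gammaMeasure a r) = ENNReal.ofReal (a * (a + 1) / r ^ 2) := by
  simp_rw [pow_two]
  rw [lintegral_ofReal_mul_gammaMeasure ha hr ENNReal.measurable_ofReal,
    lintegral_ofReal_gammaMeasure (by positivity) hr, ← ENNReal.ofReal_mul (by positivity)]
  congr 1
  ring

lemma ae_nonneg_gammaMeasure (a r : ℝ) : ∀ᵐ x ∂(gammaMeasure a r), 0 ≤ x := by
  rw [ae_iff, gammaMeasure, withDensity_apply _ (by measurability)]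
  simpa [← Iio_def] using lintegral_gammaPDF_of_nonpos (a := a) (r := r) le_rfl

lemma memLp_two_id_gammaMeasure (ha : 0 < a) (hr : 0 < r) : MemLp id 2 (gammaMeasure a r) :=
  memLp_two_of_lintegral_ofReal_sq_ne_top aemeasurable_id (ae_nonneg_gammaMeasure a r)
    (lintegral_ofReal_sq_gammaMeasure ha hr ▸ ENNReal.ofReal_ne_top)

lemma integral_id_gammaMeasure (ha : 0 < a) (hr : 0 < r) : ∫ x, x ∂(gammaMeasure a r) = a / r :=
  integral_eq_of_lintegral_ofReal aemeasurable_id (ae_nonneg_gammaMeasure a r) (by positivity)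
    (lintegral_ofReal_gammaMeasure ha hr)

lemma variance_id_gammaMeasure (ha : 0 < a) (hr : 0 < r) :
    Var[id; gammaMeasure a r] = a / r ^ 2 := by
  have := isProbabilityMeasure_gammaMeasure ha hr
  rw [variance_eq_of_lintegral_ofReal aemeasurable_id (ae_nonneg_gammaMeasure a r) (by positivity)
    (by positivity) (lintegral_ofReal_gammaMeasure ha hr) (lintegral_ofReal_sq_gammaMeasure ha hr)]
  ring

end GammaMoments

section MonotoneInterpolation

variable {ι : Type*} {s m : ι → ℝ}

lemma tendsto_div_of_monotone_of_le_of_le [Preorder ι] {l : Filter ι} {p q : ι → ι}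
    (hs : Monotone s) (hm : Monotone m) (hp : ∀ᶠ t in l, p t ≤ t) (hq : ∀ᶠ t in l, t ≤ q t)
    (hpos : ∀ᶠ t in l, 0 < m (p t)) (hsp : Tendsto (fun t => s (p t) / m (p t)) l (𝓝 1))
    (hsq : Tendsto (fun t => s (q t) / m (q t)) l (𝓝 1))
    (hmqp : Tendsto (fun t => m (q t) / m (p t)) l (𝓝 1)) :
    Tendsto (fun t => s t / m t) l (𝓝 1) := by
  have hlower : Tendsto (fun t => s (p t) / m (p t) / (m (q t) / m (p t))) l (𝓝 1) := by
    simpa [Pi.div_def] using hsp.div hmqp one_ne_zero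
  have hupper : Tendsto (fun t => s (q t) / m (q t) * (m (q t) / m (p t))) l (𝓝 1) := by
    simpa using hsq.mul hmqp
  have hsp_pos : ∀ᶠ t in l, 0 < s (p t) / m (p t) := hsp.eventually_const_lt one_pos
  refine tendsto_of_tendsto_of_tendsto_of_le_of_le' hlower hupper ?_ ?_
  all_goals
    filter_upwards [hp, hq, hpos, hsp_pos] with t hpt htq hmp hsp
    have hs_pos : 0 < s (p t) := (div_pos_iff_of_pos_right hmp).1 hsp
    have hm_pos : 0 < m t := hmp.trans_le (hm hpt)
    have hmq_pos : 0 < m (q t) := hm_pos.trans_le (hm htq)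
  · rw [div_div_div_cancel_right₀ hmp.ne']
    exact div_le_div₀ (hs_pos.le.trans (hs hpt)) (hs hpt) hm_pos (hm htq)
  · rw [div_mul_div_cancel₀ hmq_pos.ne']
    exact div_le_div₀ (hs_pos.le.trans (hs (hpt.trans htq))) (hs htq) hmp (hm hpt)

lemma tendsto_div_sq_of_mem_Ico {u : ℕ → ℝ} {D : ℝ}
    (hu : ∀ j : ℕ, u j ∈ Ico ((j : ℝ) ^ 2) ((j : ℝ) ^ 2 + D)) :
    Tendsto (fun j : ℕ => u j / (j : ℝ) ^ 2) atTop (𝓝 1) := by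
  have hupper : Tendsto (fun j : ℕ => 1 + D / (j : ℝ) ^ 2) atTop (𝓝 1) := by
    simpa using (tendsto_const_div_pow D 2 two_ne_zero).const_add 1
  refine tendsto_of_tendsto_of_tendsto_of_le_of_le' tendsto_const_nhds hupper ?_ ?_
  all_goals
    filter_upwards [eventually_gt_atTop 0] with j hj
    have hj : (0 : ℝ) < (j : ℝ) ^ 2 := by positivity
  · exact (one_le_div hj).2 (hu j).1
  · rw [one_add_div hj.ne']
    exact div_le_div_of_nonneg_right (hu j).2.le hj.le

lemma tendsto_div_of_mem_Ico_sq {u : ℕ → ℝ} {D : ℝ}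
    (hu : ∀ j : ℕ, u j ∈ Ico ((j : ℝ) ^ 2) ((j : ℝ) ^ 2 + D)) (k : ℕ) :
    Tendsto (fun j => u (j + k) / u j) atTop (𝓝 1) := by
  have hu1 := tendsto_div_sq_of_mem_Ico hu
  have hj : Tendsto (fun j : ℕ => (((j + k : ℕ) : ℝ) / j) ^ 2) atTop (𝓝 1) := by
    have := (tendsto_add_mul_div_add_mul_atTop_nhds (k : ℝ) 0 1 one_ne_zero).pow 2
    refine (by simpa using this : Tendsto _ _ (𝓝 (1 : ℝ))).congr fun j => ?_
    push_cast
    ring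
  have hprod := (((tendsto_add_atTop_iff_nat k).2 hu1).mul hj).div hu1 one_ne_zero
  simp only [mul_one, div_one, Pi.div_def] at hprod
  refine hprod.congr' ?_
  filter_upwards [eventually_gt_atTop 0] with j hj
  have hj : (j : ℝ) ≠ 0 := by positivity
  have hjk : ((j + k : ℕ) : ℝ) ≠ 0 := by positivity
  field_simp

lemma tendsto_div_of_tendsto_square_levels [LinearOrder ι] {τ : ℕ → ι} {D : ℝ} (hs : Monotone s)
    (hm : Monotone m) (hτ : ∀ j : ℕ, m (τ j) ∈ Ico ((j : ℝ) ^ 2) ((j : ℝ) ^ 2 + D))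
    (h : Tendsto (fun j => s (τ j) / m (τ j)) atTop (𝓝 1)) :
    Tendsto (fun t => s t / m t) atTop (𝓝 1) := by
  have hm_atTop : Tendsto m atTop atTop := tendsto_atTop_atTop_of_monotone hm fun b => by
    obtain ⟨j, hj⟩ := exists_nat_ge (max b 1)
    have hj1 : (1 : ℝ) ≤ j := (le_max_right _ _).trans hj
    exact ⟨τ j, by nlinarith [(hτ j).1, (le_max_left b 1).trans hj]⟩
  -- Since `i² ≤ m t - D < (i + 1)²`, the level at `i` lies below `m t`, and the level at `i + 2`
  -- lies above it once `D ≤ i`.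
  let i : ι → ℕ := fun t => ⌊√(m t - D)⌋₊
  have hi : Tendsto i atTop atTop := tendsto_nat_floor_atTop.comp
    (Real.tendsto_sqrt_atTop.comp (tendsto_atTop_add_const_right _ (-D) hm_atTop))
  have hτ_le : ∀ᶠ t in atTop, τ (i t) ≤ t := by
    filter_upwards [hm_atTop.eventually_ge_atTop D] with t ht
    have hsq : (i t : ℝ) ^ 2 ≤ m t - D :=
      (Real.le_sqrt (Nat.cast_nonneg _) (sub_nonneg.2 ht)).1 (Nat.floor_le (Real.sqrt_nonneg _))
    exact (hm.reflect_lt (by linarith [(hτ (i t)).2])).le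
  have hle_τ : ∀ᶠ t in atTop, t ≤ τ (i t + 2) := by
    filter_upwards [hi.eventually_ge_atTop ⌈D⌉₊] with t ht
    have hD : D ≤ i t := Nat.ceil_le.1 ht
    have hsq : m t - D < ((i t : ℝ) + 1) ^ 2 :=
      (Real.sqrt_lt' (by positivity)).1 (Nat.lt_floor_add_one _)
    have hlevel := (hτ (i t + 2)).1
    push_cast at hlevel
    exact (hm.reflect_lt (by nlinarith)).le
  refine tendsto_div_of_monotone_of_le_of_le hs hm hτ_le hle_τ ?_ (h.comp hi)
    (h.comp ((tendsto_add_atTop_nat 2).comp hi)) ((tendsto_div_of_mem_Ico_sq hτ 2).comp hi)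
  filter_upwards [hi.eventually_gt_atTop 0] with t ht
  exact lt_of_lt_of_le (by positivity) (hτ (i t)).1

end MonotoneInterpolation

section SecondMoment

variable {Ω : Type*} [MeasurableSpace Ω] {μ : Measure Ω}

lemma ae_tendsto_zero_of_tsum_lintegral_ne_top {g : ℕ → Ω → ℝ≥0∞} (hg : ∀ j, AEMeasurable (g j) μ)
    (h : ∑' j, ∫⁻ ω, g j ω ∂μ ≠ ∞) : ∀ᵐ ω ∂μ, Tendsto (fun j => g j ω) atTop (𝓝 0) := by
  rw [← lintegral_tsum hg] at h
  filter_upwards [ae_lt_top' (AEMeasurable.tsum hg) h] with ω hω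
  exact ENNReal.tendsto_atTop_zero_of_tsum_ne_top hω.ne

lemma ae_tendsto_sub_integral_of_summable_variance [IsFiniteMeasure μ] {Y : ℕ → Ω → ℝ}
    (hY : ∀ j, MemLp (Y j) 2 μ) (h : Summable fun j => Var[Y j; μ]) :
    ∀ᵐ ω ∂μ, Tendsto (fun j => Y j ω - μ[Y j]) atTop (𝓝 0) := by
  have hvar j : ∫⁻ ω, ENNReal.ofReal ((Y j ω - μ[Y j]) ^ 2) ∂μ = ENNReal.ofReal Var[Y j; μ] := by
    rw [ofReal_variance (hY j), evariance_eq_lintegral_ofReal]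
  have hmeas j : AEMeasurable (fun ω => ENNReal.ofReal ((Y j ω - μ[Y j]) ^ 2)) μ :=
    (((hY j).aemeasurable.sub_const _).pow_const 2).ennreal_ofReal
  filter_upwards [ae_tendsto_zero_of_tsum_lintegral_ne_top hmeas
    (by simpa only [hvar] using h.tsum_ofReal_ne_top)] with ω hω
  have hsq : Tendsto (fun j => (Y j ω - μ[Y j]) ^ 2) atTop (𝓝 0) := by
    simpa [Function.comp_def, sq_nonneg] using (ENNReal.tendsto_toReal ENNReal.zero_ne_top).comp hω
  rw [tendsto_zero_iff_abs_tendsto_zero]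
  simpa [Function.comp_def, Real.sqrt_sq_eq_abs] using hsq.sqrt

lemma ae_tendsto_div_integral_of_summable [IsFiniteMeasure μ] {Y : ℕ → Ω → ℝ}
    (hY : ∀ j, MemLp (Y j) 2 μ) (hmean : ∀ j, μ[Y j] ≠ 0)
    (h : Summable fun j => Var[Y j; μ] / μ[Y j] ^ 2) :
    ∀ᵐ ω ∂μ, Tendsto (fun j => Y j ω / μ[Y j]) atTop (𝓝 1) := by
  have hmem j : MemLp (fun ω => Y j ω / μ[Y j]) 2 μ := by
    simpa only [div_eq_mul_inv] using (hY j).mul_const (μ[Y j])⁻¹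
  have hmean_one j : ∫ ω, Y j ω / μ[Y j] ∂μ = 1 := by rw [integral_div, div_self (hmean j)]
  have hvar j : Var[fun ω => Y j ω / μ[Y j]; μ] = Var[Y j; μ] / μ[Y j] ^ 2 := by
    simp only [div_eq_mul_inv]
    rw [variance_mul_const, inv_pow]
  filter_upwards [ae_tendsto_sub_integral_of_summable_variance hmem (by simpa only [hvar])]
    with ω hω
  simp only [hmean_one] at hω
  simpa using hω.add_const 1

theorem ae_tendsto_div_integral_of_variance_le {ι : Type*} [LinearOrder ι] [IsFiniteMeasure μ]
    {S : ι → Ω → ℝ} {C D : ℝ} (hS : ∀ t, MemLp (S t) 2 μ) (hmono : ∀ᵐ ω ∂μ, Monotone (S · ω))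
    (hvar : ∀ t, Var[S t; μ] ≤ C * μ[S t])
    (hlevel : ∀ k : ℕ, ∃ t, μ[S t] ∈ Ico (k : ℝ) (k + D)) :
    ∀ᵐ ω ∂μ, Tendsto (fun t => S t ω / μ[S t]) atTop (𝓝 1) := by
  have hint t : Integrable (S t) μ := (hS t).integrable one_le_two
  have hm : Monotone fun t => μ[S t] := fun s t hst =>
    integral_mono_ae (hint s) (hint t) (hmono.mono fun ω hω => hω hst)
  have hsq (j : ℕ) : ∃ t, μ[S t] ∈ Ico ((j : ℝ) ^ 2) ((j : ℝ) ^ 2 + D) := by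
    exact_mod_cast hlevel (j ^ 2)
  choose τ hτ using hsq
  have hpos j : 0 < μ[S (τ (j + 1))] := lt_of_lt_of_le (by positivity) (hτ (j + 1)).1
  have hC : 0 ≤ C := nonneg_of_mul_nonneg_left ((variance_nonneg _ _).trans (hvar _)) (hpos 0)
  have hbound j : Var[S (τ (j + 1)); μ] / μ[S (τ (j + 1))] ^ 2 ≤ C / ((j + 1 : ℕ) : ℝ) ^ 2 :=
    calc Var[S (τ (j + 1)); μ] / μ[S (τ (j + 1))] ^ 2
        ≤ C * μ[S (τ (j + 1))] / μ[S (τ (j + 1))] ^ 2 := by gcongr; exact hvar _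
      _ = C / μ[S (τ (j + 1))] := by field_simp [(hpos j).ne']
      _ ≤ C / ((j + 1 : ℕ) : ℝ) ^ 2 := by gcongr; exact (hτ (j + 1)).1
  have hsummable : Summable fun j => Var[S (τ (j + 1)); μ] / μ[S (τ (j + 1))] ^ 2 := by
    refine Summable.of_nonneg_of_le
      (fun j => div_nonneg (variance_nonneg _ _) (sq_nonneg _)) hbound ?_
    exact ((summable_nat_add_iff 1).2 (Real.summable_one_div_nat_pow.2 one_lt_two)).mul_left C
      |>.congr fun j => by ring
  filter_upwards [ae_tendsto_div_integral_of_summable (fun j => hS (τ (j + 1)))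
    (fun j => (hpos j).ne') hsummable, hmono] with ω hω hmonoω
  exact tendsto_div_of_tendsto_square_levels hmonoω hm hτ ((tendsto_add_atTop_iff_nat 1).1 hω)

end SecondMoment

lemma exists_mem_Ico_of_le_add {u : ℕ → ℝ} {C : ℝ} (hC : 0 ≤ C) (hu₀ : u 0 ≤ 0)
    (hstep : ∀ n, u (n + 1) ≤ u n + C) (hu : Tendsto u atTop atTop) (k : ℕ) :
    ∃ n, u n ∈ Ico (k : ℝ) (k + (C + 1)) := by
  classical
  have hex : ∃ n, (k : ℝ) ≤ u n := (hu.eventually_ge_atTop _).exists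
  refine ⟨Nat.find hex, Nat.find_spec hex, ?_⟩
  rcases hn : Nat.find hex with _ | n
  · linarith [(Nat.cast_nonneg k : (0 : ℝ) ≤ k)]
  · have hlt : u n < k := not_le.1 (Nat.find_min hex (hn ▸ n.lt_succ_self))
    linarith [hstep n]

section WeightedSLLN

variable {Ω : Type*} [MeasurableSpace Ω] {μ : Measure Ω}

theorem weightedDiscreteSLLN_of_pairwise_indepFun [IsProbabilityMeasure μ] {w : ℕ → ℝ} {C V : ℝ}
    (hw : ∀ k, 0 ≤ w k) (hwC : ∀ k, w k ≤ C) (hW : Tendsto (totalWeight w) atTop atTop)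
    {X : ℕ → Ω → ℝ} (hX : ∀ k, MemLp (X k) 2 μ) (hX₀ : ∀ k, 0 ≤ᵐ[μ] X k)
    (hmean : ∀ k, μ[X k] = 1) (hvar : ∀ k, Var[X k; μ] ≤ V)
    (hindep : Pairwise fun i j => X i ⟂ᵢ[μ] X j) : WeightedDiscreteSLLN μ w X := by
  let S : ℕ → Ω → ℝ := fun n ω => ∑ k ∈ Finset.range n, w k * X k ω
  have hS n : MemLp (S n) 2 μ := memLp_finsetSum _ fun k _ => (hX k).const_mul (w k)
  have hSmean n : μ[S n] = totalWeight w n := by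
    simp only [S, totalWeight]
    rw [integral_finsetSum _ fun k _ => ((hX k).integrable one_le_two).const_mul _]
    simp only [integral_const_mul, hmean, mul_one]
  have hSmono : ∀ᵐ ω ∂μ, Monotone (S · ω) := by
    filter_upwards [ae_all_iff.2 hX₀] with ω hω
    refine monotone_nat_of_le_succ fun n => ?_
    simpa [S, Finset.sum_range_succ] using mul_nonneg (hw n) (hω n)
  have hSvar n : Var[S n; μ] ≤ C * V * μ[S n] := by
    have hsum : S n = ∑ k ∈ Finset.range n, fun ω => w k * X k ω := by ext ω; simp [S]
    rw [hSmean, hsum, IndepFun.variance_sum (fun k _ => (hX k).const_mul (w k)) fun i _ j _ hij =>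
      (hindep hij).comp (measurable_const_mul (w i)) (measurable_const_mul (w j))]
    simp only [totalWeight, Finset.mul_sum, variance_const_mul]
    refine Finset.sum_le_sum fun k _ => ?_
    calc w k ^ 2 * Var[X k; μ] ≤ (C * w k) * V :=
          mul_le_mul (by nlinarith [hw k, hwC k]) (hvar k) (variance_nonneg _ _)
            (mul_nonneg ((hw k).trans (hwC k)) (hw k))
      _ = C * V * w k := by ring
  have hlevel := exists_mem_Ico_of_le_add ((hw 0).trans (hwC 0)) (u := totalWeight w)
    (by simp [totalWeight]) (fun n => by simpa [totalWeight, Finset.sum_range_succ] using hwC n) hW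
  have hlim := ae_tendsto_div_integral_of_variance_le hS hSmono hSvar (by simpa only [hSmean])
  simp only [hSmean] at hlim
  exact hlim

theorem weightedDiscreteSLLN_of_hasLaw_expMeasure [IsProbabilityMeasure μ] {w : ℕ → ℝ} {C : ℝ}
    (hw : ∀ k, 0 ≤ w k) (hwC : ∀ k, w k ≤ C) (hW : Tendsto (totalWeight w) atTop atTop)
    {X : ℕ → Ω → ℝ} (hX : ∀ k, HasLaw (X k) (expMeasure 1) μ)
    (hindep : Pairwise fun i j => X i ⟂ᵢ[μ] X j) : WeightedDiscreteSLLN μ w X := by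
  refine weightedDiscreteSLLN_of_pairwise_indepFun (V := 1) hw hwC hW (fun k => ?_) (fun k => ?_)
    (fun k => ?_) (fun k => ?_) hindep
  · have hid : MemLp id 2 (μ.map (X k)) :=
      (hX k).map_eq ▸ memLp_two_id_gammaMeasure one_pos one_pos
    exact hid.comp_of_map (hX k).aemeasurable
  · exact (hX k).ae_iff (p := fun x => 0 ≤ x) (by fun_prop) |>.2 (ae_nonneg_gammaMeasure 1 1)
  · simpa using (hX k).integral_eq.trans (integral_id_gammaMeasure one_pos one_pos)
  · simpa using ((hX k).variance_eq.trans (variance_id_gammaMeasure one_pos one_pos)).le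

end WeightedSLLN

section RandomMeasure

variable {Ω : Type*} [MeasurableSpace Ω] {μ : Measure Ω} {κ : Ω → Measure ℝ} {ν : Measure ℝ}

lemma lintegral_mul_lintegral_eq_of_Iic [IsFiniteMeasure ν] (hκ : Measurable κ) {u : Ω → ℝ≥0∞}
    (hu : AEMeasurable u μ) (h : ∀ x, ∫⁻ ω, u ω * κ ω (Iic x) ∂μ = ν (Iic x)) {g : ℝ → ℝ≥0∞}
    (hg : Measurable g) : ∫⁻ ω, u ω * ∫⁻ x, g x ∂(κ ω) ∂μ = ∫⁻ x, g x ∂ν := by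
  have hbind : (μ.withDensity u).bind κ = ν := by
    refine (Measure.ext_of_Iic _ _ fun x => ?_).symm
    have hκx : Measurable fun ω => κ ω (Iic x) :=
      (Measure.measurable_coe measurableSet_Iic).comp hκ
    rw [Measure.bind_apply measurableSet_Iic hκ.aemeasurable,
      lintegral_withDensity_eq_lintegral_mul₀ hu hκx.aemeasurable]
    exact (h x).symm
  have hκg : Measurable fun ω => ∫⁻ x, g x ∂(κ ω) := (Measure.measurable_lintegral hg).comp hκ
  rw [← hbind, Measure.lintegral_bind hκ.aemeasurable hg.aemeasurable,
    lintegral_withDensity_eq_lintegral_mul₀ hu hκg.aemeasurable]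
  rfl

/-- `HasPoissonMoments κ ν μ`: under `μ`, the random measure `κ` on `ℝ` has intensity `ν` and the
second moments `E[κ(A) κ(B)] = ν(A) ν(B) + ν(A ∩ B)` of a Poisson random measure. Both identities
are only asked for half-lines, which is enough to integrate functions. -/
structure HasPoissonMoments (κ : Ω → Measure ℝ) (ν : Measure ℝ) (μ : Measure Ω) : Prop where
  measurable : Measurable κ
  lintegral_Iic : ∀ x, ∫⁻ ω, κ ω (Iic x) ∂μ = ν (Iic x)
  lintegral_Iic_mul_Iic : ∀ x y, ∫⁻ ω, κ ω (Iic x) * κ ω (Iic y) ∂μ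
    = ν (Iic x) * ν (Iic y) + ν (Iic x ∩ Iic y)

namespace HasPoissonMoments

variable [IsFiniteMeasure ν] {g : ℝ → ℝ≥0∞} {f : ℝ → ℝ}

lemma bind_eq (h : HasPoissonMoments κ ν μ) : μ.bind κ = ν := by
  refine (Measure.ext_of_Iic _ _ fun x => ?_).symm
  rw [Measure.bind_apply measurableSet_Iic h.measurable.aemeasurable, h.lintegral_Iic]

lemma ae_ae (h : HasPoissonMoments κ ν μ) {p : ℝ → Prop} (hp : ∀ᵐ x ∂ν, p x) :
    ∀ᵐ ω ∂μ, ∀ᵐ x ∂(κ ω), p x :=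
  Measure.ae_ae_of_ae_bind h.measurable.aemeasurable (h.bind_eq.symm ▸ hp)

lemma aemeasurable_lintegral (h : HasPoissonMoments κ ν μ) (hg : AEMeasurable g ν) :
    AEMeasurable (fun ω => ∫⁻ x, g x ∂(κ ω)) μ :=
  ⟨fun ω => ∫⁻ x, hg.mk g x ∂(κ ω),
    (Measure.measurable_lintegral hg.measurable_mk).comp h.measurable,
    (h.ae_ae hg.ae_eq_mk).mono fun _ => lintegral_congr_ae⟩

lemma lintegral_lintegral (h : HasPoissonMoments κ ν μ) (hg : AEMeasurable g ν) :
    ∫⁻ ω, ∫⁻ x, g x ∂(κ ω) ∂μ = ∫⁻ x, g x ∂ν := by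
  rw [← h.bind_eq] at hg ⊢
  exact (Measure.lintegral_bind h.measurable.aemeasurable hg).symm

lemma lintegral_Iic_mul_lintegral (h : HasPoissonMoments κ ν μ) (hg : Measurable g) (x : ℝ) :
    ∫⁻ ω, κ ω (Iic x) * ∫⁻ y, g y ∂(κ ω) ∂μ
      = ν (Iic x) * ∫⁻ y, g y ∂ν + ∫⁻ y in Iic x, g y ∂ν := by
  have hκx : Measurable fun ω => κ ω (Iic x) :=
    (Measure.measurable_coe measurableSet_Iic).comp h.measurable
  have := ν.smul_finite (measure_ne_top ν (Iic x))
  rw [lintegral_mul_lintegral_eq_of_Iic (ν := ν (Iic x) • ν + ν.restrict (Iic x)) h.measurable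
    hκx.aemeasurable _ hg, lintegral_add_measure, lintegral_smul_measure, smul_eq_mul]
  intro y
  simpa [inter_comm] using h.lintegral_Iic_mul_Iic x y

lemma lintegral_lintegral_sq (h : HasPoissonMoments κ ν μ) (hg : AEMeasurable g ν)
    (hfin : ∫⁻ x, g x ∂ν ≠ ∞) :
    ∫⁻ ω, (∫⁻ x, g x ∂(κ ω)) ^ 2 ∂μ = (∫⁻ x, g x ∂ν) ^ 2 + ∫⁻ x, g x ^ 2 ∂ν := by
  wlog hmeas : Measurable g generalizing g
  · have hmk := hg.ae_eq_mk
    have hmk_sq : ∫⁻ x, g x ^ 2 ∂ν = ∫⁻ x, hg.mk g x ^ 2 ∂ν := lintegral_congr_ae (hmk.pow_const 2)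
    rw [lintegral_congr_ae hmk] at hfin ⊢
    rw [hmk_sq, ← this hg.measurable_mk.aemeasurable hfin hg.measurable_mk]
    refine lintegral_congr_ae ?_
    filter_upwards [h.ae_ae hmk] with ω hω
    rw [lintegral_congr_ae hω]
  have := ν.smul_finite hfin
  have := isFiniteMeasure_withDensity hfin
  simp only [pow_two]
  rw [lintegral_mul_lintegral_eq_of_Iic (ν := (∫⁻ x, g x ∂ν) • ν + ν.withDensity g) h.measurable
    (h.aemeasurable_lintegral hg) _ hmeas, lintegral_add_measure, lintegral_smul_measure,
    lintegral_withDensity_eq_lintegral_mul _ hmeas hmeas, smul_eq_mul]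
  · rfl
  intro x
  simpa [mul_comm, withDensity_apply] using h.lintegral_Iic_mul_lintegral hmeas x

lemma ae_integrable (h : HasPoissonMoments κ ν μ) (hf : Integrable f ν) :
    ∀ᵐ ω ∂μ, Integrable f (κ ω) := by
  have hfin : ∫⁻ ω, ∫⁻ x, ‖f x‖ₑ ∂(κ ω) ∂μ ≠ ∞ := by
    rw [h.lintegral_lintegral hf.aestronglyMeasurable.enorm]
    exact hf.hasFiniteIntegral.ne
  have hmk := hf.aestronglyMeasurable.ae_eq_mk
  filter_upwards [h.ae_ae hmk,
    ae_lt_top' (h.aemeasurable_lintegral hf.aestronglyMeasurable.enorm) hfin] with ω hω hωfin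
  exact ⟨⟨_, hf.aestronglyMeasurable.stronglyMeasurable_mk, hω⟩, hωfin⟩

lemma ae_ofReal_integral_eq (h : HasPoissonMoments κ ν μ) (hf : Integrable f ν)
    (hf₀ : 0 ≤ᵐ[ν] f) :
    (fun ω => ENNReal.ofReal (∫ x, f x ∂(κ ω))) =ᵐ[μ]
      fun ω => ∫⁻ x, ENNReal.ofReal (f x) ∂(κ ω) := by
  filter_upwards [h.ae_integrable hf, h.ae_ae hf₀] with ω hfω hf₀ω
  exact ofReal_integral_eq_lintegral_ofReal hfω hf₀ω

lemma ae_integral_nonneg (h : HasPoissonMoments κ ν μ) (hf₀ : 0 ≤ᵐ[ν] f) :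
    ∀ᵐ ω ∂μ, 0 ≤ ∫ x, f x ∂(κ ω) :=
  (h.ae_ae hf₀).mono fun _ => integral_nonneg_of_ae

lemma aemeasurable_integral (h : HasPoissonMoments κ ν μ) (hf : Integrable f ν)
    (hf₀ : 0 ≤ᵐ[ν] f) : AEMeasurable (fun ω => ∫ x, f x ∂(κ ω)) μ := by
  refine (h.aemeasurable_lintegral hf.aemeasurable.ennreal_ofReal).ennreal_toReal.congr ?_
  filter_upwards [h.ae_ofReal_integral_eq hf hf₀, h.ae_integral_nonneg hf₀] with ω hω hω₀
  rw [← hω, ENNReal.toReal_ofReal hω₀]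

lemma lintegral_ofReal_integral (h : HasPoissonMoments κ ν μ) (hf : Integrable f ν)
    (hf₀ : 0 ≤ᵐ[ν] f) :
    ∫⁻ ω, ENNReal.ofReal (∫ x, f x ∂(κ ω)) ∂μ = ENNReal.ofReal (∫ x, f x ∂ν) := by
  rw [lintegral_congr_ae (h.ae_ofReal_integral_eq hf hf₀),
    h.lintegral_lintegral hf.aemeasurable.ennreal_ofReal,
    ofReal_integral_eq_lintegral_ofReal hf hf₀]

lemma lintegral_ofReal_integral_sq (h : HasPoissonMoments κ ν μ) (hf : MemLp f 2 ν)
    (hf₀ : 0 ≤ᵐ[ν] f) :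
    ∫⁻ ω, ENNReal.ofReal (∫ x, f x ∂(κ ω)) ^ 2 ∂μ
      = ENNReal.ofReal ((∫ x, f x ∂ν) ^ 2 + ∫ x, f x ^ 2 ∂ν) := by
  have hint := hf.integrable one_le_two
  have hsq : ∫⁻ x, ENNReal.ofReal (f x) ^ 2 ∂ν = ENNReal.ofReal (∫ x, f x ^ 2 ∂ν) := by
    rw [ofReal_integral_eq_lintegral_ofReal hf.integrable_sq (ae_of_all _ fun x => sq_nonneg _)]
    exact lintegral_congr_ae (hf₀.mono fun x hx => (ENNReal.ofReal_pow hx 2).symm)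
  have hlint := ofReal_integral_eq_lintegral_ofReal hint hf₀
  have hκ : ∫⁻ ω, ENNReal.ofReal (∫ x, f x ∂(κ ω)) ^ 2 ∂μ
      = ∫⁻ ω, (∫⁻ x, ENNReal.ofReal (f x) ∂(κ ω)) ^ 2 ∂μ :=
    lintegral_congr_ae ((h.ae_ofReal_integral_eq hint hf₀).pow_const 2)
  rw [hκ, h.lintegral_lintegral_sq hint.aemeasurable.ennreal_ofReal (hlint ▸ ENNReal.ofReal_ne_top),
    ← hlint, hsq, ENNReal.ofReal_add (sq_nonneg _) (integral_nonneg fun x => sq_nonneg _),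
    ENNReal.ofReal_pow (integral_nonneg_of_ae hf₀)]

lemma integral_integral (h : HasPoissonMoments κ ν μ) (hf : Integrable f ν) (hf₀ : 0 ≤ᵐ[ν] f) :
    ∫ ω, ∫ x, f x ∂(κ ω) ∂μ = ∫ x, f x ∂ν :=
  integral_eq_of_lintegral_ofReal (h.aemeasurable_integral hf hf₀) (h.ae_integral_nonneg hf₀)
    (integral_nonneg_of_ae hf₀) (h.lintegral_ofReal_integral hf hf₀)

lemma memLp_two_integral (h : HasPoissonMoments κ ν μ) (hf : MemLp f 2 ν) (hf₀ : 0 ≤ᵐ[ν] f) :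
    MemLp (fun ω => ∫ x, f x ∂(κ ω)) 2 μ :=
  memLp_two_of_lintegral_ofReal_sq_ne_top
    (h.aemeasurable_integral (hf.integrable one_le_two) hf₀) (h.ae_integral_nonneg hf₀)
    (h.lintegral_ofReal_integral_sq hf hf₀ ▸ ENNReal.ofReal_ne_top)

lemma variance_integral [IsProbabilityMeasure μ] (h : HasPoissonMoments κ ν μ) (hf : MemLp f 2 ν)
    (hf₀ : 0 ≤ᵐ[ν] f) : Var[fun ω => ∫ x, f x ∂(κ ω); μ] = ∫ x, f x ^ 2 ∂ν := by
  have hint := hf.integrable one_le_two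
  have hsq : 0 ≤ ∫ x, f x ^ 2 ∂ν := integral_nonneg fun x => sq_nonneg _
  rw [variance_eq_of_lintegral_ofReal (h.aemeasurable_integral hint hf₀)
    (h.ae_integral_nonneg hf₀) (integral_nonneg_of_ae hf₀) (add_nonneg (sq_nonneg _) hsq)
    (h.lintegral_ofReal_integral hint hf₀) (h.lintegral_ofReal_integral_sq hf hf₀),
    add_sub_cancel_left]

end HasPoissonMoments

end RandomMeasure

section IocIntegrals

variable {f : ℝ → ℝ} {ν : Measure ℝ}

lemma ae_nonneg_restrict_Ioc (hf : ∀ x, 0 < x → 0 ≤ f x) (t : ℝ) :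
    0 ≤ᵐ[ν.restrict (Ioc 0 t)] f :=
  ae_restrict_of_forall_mem measurableSet_Ioc fun x hx => hf x hx.1

lemma setIntegral_Ioc_eq_add_indicator {a b c : ℝ} (hab : a ≤ b) (hbc : b ≤ c)
    (hf : IntegrableOn f (Ioc a c) ν) :
    ∫ x in Ioc a c, f x ∂ν
      = ∫ x in Ioc a b, f x ∂ν + ∫ x in Ioc a c, (Ioi b).indicator f x ∂ν := by
  rw [setIntegral_indicator measurableSet_Ioi, Ioc_inter_Ioi, sup_eq_right.2 hab,
    ← Ioc_union_Ioc_eq_Ioc hab hbc]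
  exact setIntegral_union (Ioc_disjoint_Ioc_of_le le_rfl) measurableSet_Ioc
    (hf.mono_set (Ioc_subset_Ioc_right hbc)) (hf.mono_set (Ioc_subset_Ioc_left hab))

lemma lam_le_add {M a b : ℝ} (hfM : ∀ x, 0 < x → f x ≤ M)
    (hf : ∀ t : ℝ, IntegrableOn f (Ioc 0 t)) (ha : 0 ≤ a) (hab : a ≤ b) :
    lam f b ≤ lam f a + M * (b - a) := by
  have hsub : Ioc a b ⊆ Ioc 0 b := Ioc_subset_Ioc_left ha
  have hbound : ∫ x in Ioc a b, f x ≤ M * (b - a) := by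
    calc ∫ x in Ioc a b, f x ≤ ∫ _ in Ioc a b, M :=
          setIntegral_mono_on ((hf b).mono_set hsub) (by simp) measurableSet_Ioc
            fun x hx => hfM x (ha.trans_lt hx.1)
      _ = M * (b - a) := by simp [hab, mul_comm]
  rw [lam, lam, ← Ioc_union_Ioc_eq_Ioc ha hab, setIntegral_union
    (Ioc_disjoint_Ioc_of_le le_rfl) measurableSet_Ioc (hf a) ((hf b).mono_set hsub)]
  gcongr

end IocIntegrals

lemma tendsto_add_div_add_of_tendsto_div {ι : Type*} {l : Filter ι} {s m : ι → ℝ} (A B : ℝ)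
    (hm : Tendsto m l atTop) (h : Tendsto (fun t => s t / m t) l (𝓝 1)) :
    Tendsto (fun t => (A + s t) / (B + m t)) l (𝓝 1) := by
  have hlim : Tendsto (fun t => (A / m t + s t / m t) / (B / m t + 1)) l (𝓝 ((0 + 1) / (0 + 1))) :=
    ((hm.const_div_atTop A).add h).div ((hm.const_div_atTop B).add_const 1) (by norm_num)
  rw [zero_add, div_one] at hlim
  refine hlim.congr' ?_
  filter_upwards [hm.eventually_gt_atTop 0] with t ht
  rw [← add_div, div_add_one ht.ne', div_div_div_cancel_right₀ ht.ne']

lemma tendstoInMeasure_of_tendsto_ae_of_isCountablyGenerated {Ω ι E : Type*} [MeasurableSpace Ω]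
    {μ : Measure Ω} [IsFiniteMeasure μ] [PseudoEMetricSpace E] {l : Filter ι}
    [l.IsCountablyGenerated] {Y : ι → Ω → E} {Z : Ω → E}
    (hY : ∀ t, AEStronglyMeasurable (Y t) μ)
    (h : ∀ᵐ ω ∂μ, Tendsto (fun t => Y t ω) l (𝓝 (Z ω))) : TendstoInMeasure μ Y l Z := fun ε hε =>
  tendsto_of_seq_tendsto fun _ hu => tendstoInMeasure_of_tendsto_ae (fun _ => hY _)
    (h.mono fun _ hω => hω.comp hu) ε hε

namespace IsGammaProcess

variable {Ω : Type*} [MeasurableSpace Ω] {Γ : ℝ≥0 → Ω → ℝ} {μ : Measure Ω} {f : ℝ → ℝ} {M : ℝ}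

lemma nonneg (h : IsGammaProcess Γ μ) (t : ℝ≥0) (ω : Ω) : 0 ≤ Γ t ω := by
  simpa [h.zero ω] using h.mono ω zero_le

lemma lintegral_ofReal_sub (h : IsGammaProcess Γ μ) {s t : ℝ≥0} (hst : s ≤ t) :
    ∫⁻ ω, ENNReal.ofReal (Γ t ω - Γ s ω) ∂μ = (t - s : ℝ≥0) := by
  rcases hst.eq_or_lt with rfl | hst
  · simp
  · have hpos : (0 : ℝ) < t - s := sub_pos.2 (NNReal.coe_lt_coe.2 hst)
    rw [(h.law s t hst).lintegral_comp ENNReal.measurable_ofReal.aemeasurable,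
      lintegral_ofReal_gammaMeasure hpos one_pos, div_one, ← NNReal.coe_sub hst.le,
      ENNReal.ofReal_coe_nnreal]

lemma lintegral_ofReal (h : IsGammaProcess Γ μ) (t : ℝ≥0) :
    ∫⁻ ω, ENNReal.ofReal (Γ t ω) ∂μ = t := by
  simpa [h.zero] using h.lintegral_ofReal_sub zero_le

lemma lintegral_ofReal_sq (h : IsGammaProcess Γ μ) (t : ℝ≥0) :
    ∫⁻ ω, ENNReal.ofReal (Γ t ω) ^ 2 ∂μ = t ^ 2 + t := by
  rcases eq_zero_or_pos t with rfl | ht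
  · simp [h.zero]
  · have hlaw : HasLaw (Γ t) (gammaMeasure t 1) μ := by simpa [h.zero] using h.law 0 t ht
    rw [hlaw.lintegral_comp (ENNReal.measurable_ofReal.pow_const 2).aemeasurable,
      lintegral_ofReal_sq_gammaMeasure (NNReal.coe_pos.2 ht) one_pos]
    norm_cast
    rw [ENNReal.ofReal_coe_nnreal]
    congr 1
    ring

lemma lintegral_ofReal_mul_ofReal (h : IsGammaProcess Γ μ) (s t : ℝ≥0) :
    ∫⁻ ω, ENNReal.ofReal (Γ s ω) * ENNReal.ofReal (Γ t ω) ∂μ = s * t + (min s t : ℝ≥0) := by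
  wlog hst : s ≤ t generalizing s t
  · simpa only [mul_comm, min_comm] using this t s (le_of_not_ge hst)
  have hΓs : Measurable fun ω => ENNReal.ofReal (Γ s ω) := (h.measurable s).ennreal_ofReal
  have hincr : Measurable fun ω => ENNReal.ofReal (Γ t ω - Γ s ω) :=
    ((h.measurable t).sub (h.measurable s)).ennreal_ofReal
  have hindep : Γ s ⟂ᵢ[μ] Γ t - Γ s := h.indep.indepFun_eval_sub zero_le hst (ae_of_all _ h.zero)
  have hprod : ∫⁻ ω, ENNReal.ofReal (Γ s ω) * ENNReal.ofReal (Γ t ω - Γ s ω) ∂μ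
      = s * (t - s : ℝ≥0) := by
    rw [lintegral_mul_eq_lintegral_mul_lintegral_of_indepFun'' hΓs.aemeasurable hincr.aemeasurable
      (hindep.comp ENNReal.measurable_ofReal ENNReal.measurable_ofReal), h.lintegral_ofReal,
      h.lintegral_ofReal_sub hst]
  have hsplit ω : ENNReal.ofReal (Γ s ω) * ENNReal.ofReal (Γ t ω)
      = ENNReal.ofReal (Γ s ω) ^ 2
        + ENNReal.ofReal (Γ s ω) * ENNReal.ofReal (Γ t ω - Γ s ω) := by
    rw [sq, ← mul_add, ← ENNReal.ofReal_add (h.nonneg s ω) (sub_nonneg.2 (h.mono ω hst)),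
      add_sub_cancel]
  simp only [hsplit]
  rw [lintegral_add_left (hΓs.pow_const 2), hprod, h.lintegral_ofReal_sq, min_eq_left hst]
  norm_cast
  rw [add_right_comm, sq, ← mul_add, add_tsub_cancel_of_le hst]

lemma restrict_pathMeasure_Iic (h : IsGammaProcess Γ μ) (t x : ℝ) (ω : Ω) :
    (h.pathMeasure ω).restrict (Ioc 0 t) (Iic x) = ENNReal.ofReal (Γ (min t x).toNNReal ω) := by
  rw [Measure.restrict_apply measurableSet_Iic, inter_comm, Ioc_inter_Iic, pathMeasure,
    StieltjesFunction.measure_Ioc]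
  simp [path, h.zero]

lemma measurable_restrict_pathMeasure (h : IsGammaProcess Γ μ) (t : ℝ) :
    Measurable fun ω => (h.pathMeasure ω).restrict (Ioc 0 t) := by
  have hIoc (ω : Ω) : h.pathMeasure ω (Ioc 0 t) = ENNReal.ofReal (Γ t.toNNReal ω) := by
    simp [pathMeasure, path, h.zero]
  have (ω : Ω) : IsFiniteMeasure ((h.pathMeasure ω).restrict (Ioc 0 t)) :=
    isFiniteMeasure_restrict.2 (hIoc ω ▸ ENNReal.ofReal_ne_top)
  refine Measurable.measure_of_isPiSystem (borel_eq_generateFrom_Iic ℝ ▸ BorelSpace.measurable_eq)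
    isPiSystem_Iic ?_ ?_
  · rintro _ ⟨x, rfl⟩
    simpa only [h.restrict_pathMeasure_Iic] using (h.measurable _).ennreal_ofReal
  · simpa only [Measure.restrict_apply_univ, hIoc] using (h.measurable _).ennreal_ofReal

theorem hasPoissonMoments (h : IsGammaProcess Γ μ) (t : ℝ) :
    HasPoissonMoments (fun ω => (h.pathMeasure ω).restrict (Ioc 0 t)) (volume.restrict (Ioc 0 t))
      μ := by
  have hvol (x : ℝ) : volume.restrict (Ioc 0 t) (Iic x) = (min t x).toNNReal := by
    rw [Measure.restrict_apply measurableSet_Iic, inter_comm, Ioc_inter_Iic, Real.volume_Ioc,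
      sub_zero]
    rfl
  refine ⟨h.measurable_restrict_pathMeasure t, fun x => ?_, fun x y => ?_⟩
  · simp only [h.restrict_pathMeasure_Iic, hvol, h.lintegral_ofReal]
  · have hmin : min (min t x).toNNReal (min t y).toNNReal = (min t (min x y)).toNNReal := by
      rw [← Monotone.map_min fun _ _ => Real.toNNReal_le_toNNReal, ← inf_inf_distrib_left]
    simp only [h.restrict_pathMeasure_Iic, Iic_inter_Iic, hvol, h.lintegral_ofReal_mul_ofReal,
      hmin]

lemma ae_integrableOn (h : IsGammaProcess Γ μ) (hf : ∀ t : ℝ, IntegrableOn f (Ioc 0 t)) :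
    ∀ᵐ ω ∂μ, ∀ t : ℝ, IntegrableOn f (Ioc 0 t) (h.pathMeasure ω) := by
  filter_upwards [ae_all_iff.2 fun n : ℕ => (h.hasPoissonMoments n).ae_integrable (hf n)]
    with ω hω t
  obtain ⟨n, hn⟩ := exists_nat_ge t
  exact IntegrableOn.mono_set (hω n) (Ioc_subset_Ioc_right hn)

lemma aemeasurable_gammaIntegral (h : IsGammaProcess Γ μ) (hf₀ : ∀ x, 0 < x → 0 ≤ f x) {t : ℝ}
    (hf : IntegrableOn f (Ioc 0 t)) : AEMeasurable (h.gammaIntegral f t) μ :=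
  (h.hasPoissonMoments t).aemeasurable_integral hf (ae_nonneg_restrict_Ioc hf₀ t)

lemma integral_gammaIntegral (h : IsGammaProcess Γ μ) (hf₀ : ∀ x, 0 < x → 0 ≤ f x) {t : ℝ}
    (hf : IntegrableOn f (Ioc 0 t)) : μ[h.gammaIntegral f t] = lam f t :=
  (h.hasPoissonMoments t).integral_integral hf (ae_nonneg_restrict_Ioc hf₀ t)

lemma memLp_two_gammaIntegral (h : IsGammaProcess Γ μ) (hf₀ : ∀ x, 0 < x → 0 ≤ f x) {t : ℝ}
    (hf : MemLp f 2 (volume.restrict (Ioc 0 t))) : MemLp (h.gammaIntegral f t) 2 μ :=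
  (h.hasPoissonMoments t).memLp_two_integral hf (ae_nonneg_restrict_Ioc hf₀ t)

lemma variance_gammaIntegral [IsProbabilityMeasure μ] (h : IsGammaProcess Γ μ)
    (hf₀ : ∀ x, 0 < x → 0 ≤ f x) {t : ℝ} (hf : MemLp f 2 (volume.restrict (Ioc 0 t))) :
    Var[h.gammaIntegral f t; μ] = lam (fun x => f x ^ 2) t :=
  (h.hasPoissonMoments t).variance_integral hf (ae_nonneg_restrict_Ioc hf₀ t)

lemma ae_monotone_gammaIntegral (h : IsGammaProcess Γ μ) (hf₀ : ∀ x, 0 < x → 0 ≤ f x)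
    (hf : ∀ t : ℝ, IntegrableOn f (Ioc 0 t)) :
    ∀ᵐ ω ∂μ, Monotone fun t => h.gammaIntegral f t ω := by
  filter_upwards [h.ae_integrableOn hf] with ω hω s t hst
  exact setIntegral_mono_set (hω t) (ae_nonneg_restrict_Ioc hf₀ t)
    (Ioc_subset_Ioc_right hst).eventuallyLE

theorem ae_tendsto_ratio_of_le [IsProbabilityMeasure μ] (h : IsGammaProcess Γ μ)
    (hf₀ : ∀ x, 0 < x → 0 ≤ f x) (hfM : ∀ x, 0 < x → f x ≤ M)
    (hf : ∀ t : ℝ, IntegrableOn f (Ioc 0 t)) (hlam : Tendsto (lam f) atTop atTop) :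
    ∀ᵐ ω ∂μ, Tendsto (fun t => h.ratio f t ω) atTop (𝓝 1) := by
  have hmem t : MemLp f 2 (volume.restrict (Ioc 0 t)) :=
    MemLp.of_bound (hf t).aestronglyMeasurable M <|
      ae_restrict_of_forall_mem measurableSet_Ioc fun x hx => by
        simpa [abs_of_nonneg (hf₀ x hx.1)] using hfM x hx.1
  have hmean t : μ[h.gammaIntegral f t] = lam f t := h.integral_gammaIntegral hf₀ (hf t)
  have hvar t : Var[h.gammaIntegral f t; μ] ≤ M * μ[h.gammaIntegral f t] := by
    rw [h.variance_gammaIntegral hf₀ (hmem t), hmean, lam, lam, ← integral_const_mul]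
    refine setIntegral_mono_on (hmem t).integrable_sq ((hf t).const_mul M) measurableSet_Ioc
      fun x hx => ?_
    rw [sq]
    exact mul_le_mul_of_nonneg_right (hfM x hx.1) (hf₀ x hx.1)
  have hlevel (k : ℕ) : ∃ t, μ[h.gammaIntegral f t] ∈ Ico (k : ℝ) (k + (M + 1)) := by
    obtain ⟨n, hn⟩ := exists_mem_Ico_of_le_add (u := fun n : ℕ => lam f n)
      ((hf₀ 1 one_pos).trans (hfM 1 one_pos)) (by simp [lam])
      (fun n => by simpa using lam_le_add hfM hf n.cast_nonneg (b := (n + 1 : ℝ)) (by simp))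
      (hlam.comp tendsto_natCast_atTop_atTop) k
    exact ⟨n, hmean n ▸ hn⟩
  have hlim := ae_tendsto_div_integral_of_variance_le
    (fun t => h.memLp_two_gammaIntegral hf₀ (hmem t)) (h.ae_monotone_gammaIntegral hf₀ hf) hvar
    hlevel
  simp only [hmean] at hlim
  exact hlim

theorem orderlyDivergenceAS_of_bddAbove [IsProbabilityMeasure μ] (h : IsGammaProcess Γ μ)
    (hf₀ : ∀ x, 0 < x → 0 ≤ f x) {a : ℝ} (ha : BddAbove (f '' Ioi a))
    (hf : ∀ t : ℝ, IntegrableOn f (Ioc 0 t)) (hlam : Tendsto (lam f) atTop atTop) :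
    OrderlyDivergenceAS h f := by
  let b := max a 0
  let g := (Ioi b).indicator f
  obtain ⟨M, hM⟩ := ha
  have hb : 0 ≤ b := le_max_right a 0
  have hg₀ (x : ℝ) (hx : 0 < x) : 0 ≤ g x := indicator_apply_nonneg fun _ => hf₀ x hx
  have hgM (x : ℝ) : g x ≤ M := by
    refine indicator_apply_le' (fun hx => hM ⟨x, (le_max_left a 0).trans_lt hx, rfl⟩) fun _ => ?_
    have hb1 : b < b + 1 := lt_add_one b
    exact (hf₀ _ (hb.trans_lt hb1)).trans (hM ⟨b + 1, (le_max_left a 0).trans_lt hb1, rfl⟩)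
  have hg t : IntegrableOn g (Ioc 0 t) := (hf t).indicator measurableSet_Ioi
  have hlam_split t (ht : b ≤ t) : lam f t = lam f b + lam g t :=
    setIntegral_Ioc_eq_add_indicator hb ht (hf t)
  have hlamg : Tendsto (lam g) atTop atTop := by
    refine (tendsto_atTop_add_const_left _ (-lam f b) hlam).congr' ?_
    filter_upwards [eventually_ge_atTop b] with t ht
    rw [hlam_split t ht, neg_add_cancel_left]
  filter_upwards [h.ae_integrableOn hf, h.ae_tendsto_ratio_of_le hg₀ (fun x _ => hgM x) hg hlamg]
    with ω hω hlim
  refine ⟨hω, (tendsto_add_div_add_of_tendsto_div (h.gammaIntegral f b ω) (lam f b) hlamg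
    hlim).congr' ?_⟩
  filter_upwards [eventually_ge_atTop b] with t ht
  have hΓ_split : h.gammaIntegral f t ω = h.gammaIntegral f b ω + h.gammaIntegral g t ω :=
    setIntegral_Ioc_eq_add_indicator hb ht (hω t)
  rw [ratio, hΓ_split, hlam_split t ht]

theorem orderlyDivergence_of_orderlyDivergenceAS [IsFiniteMeasure μ] (h : IsGammaProcess Γ μ)
    (hf₀ : ∀ x, 0 < x → 0 ≤ f x) (hf : ∀ t : ℝ, IntegrableOn f (Ioc 0 t))
    (hAS : OrderlyDivergenceAS h f) : OrderlyDivergence h f :=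
  tendstoInMeasure_of_tendsto_ae_of_isCountablyGenerated
    (fun t => ((h.aemeasurable_gammaIntegral hf₀ (hf t)).div_const _).aestronglyMeasurable)
    (hAS.mono fun _ hω => hω.2)

end IsGammaProcess

lemma bddAbove_image_Ioi_of_antitoneOn {α β : Type*} [Preorder α] [Preorder β] {f : α → β}
    {a b : α} (hab : a < b) (hf : AntitoneOn f (Ioi a)) : BddAbove (f '' Ioi b) :=
  ⟨f b, forall_mem_image.2 fun _ hx => hf hab (hab.trans hx) (le_of_lt hx)⟩

theorem mainTheorem7_general {Ω : Type*} [MeasurableSpace Ω] (μ : Measure Ω)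
    [IsProbabilityMeasure μ] (f : ℝ → ℝ) (hf : ∀ x : ℝ, 0 < x → 0 ≤ f x) :
    (BddAbove (f '' Ioi 0) →
      Tendsto (totalWeight (sampledWeights f)) atTop atTop →
      ∀ X : ℕ → Ω → ℝ, (Pairwise fun i j => X i ⟂ᵢ[μ] X j) →
        (∀ k, HasLaw (X k) (expMeasure 1) μ) → WeightedDiscreteSLLN μ (sampledWeights f) X) ∧
    (∀ a : ℝ, BddAbove (f '' Ioi a) →
      (∀ t : ℝ, IntegrableOn f (Ioc 0 t)) →
      Tendsto (lam f) atTop atTop →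
      ∀ (Γ : ℝ≥0 → Ω → ℝ) (hΓ : IsGammaProcess Γ μ),
        OrderlyDivergenceAS hΓ f ∧ OrderlyDivergence hΓ f) := by
  refine ⟨fun ⟨C, hC⟩ hW X hindep hX => ?_, fun a ha hint hlam Γ hΓ => ?_⟩
  · have hpos (k : ℕ) : (0 : ℝ) < k + 1 := k.cast_add_one_pos
    exact weightedDiscreteSLLN_of_hasLaw_expMeasure (fun k => hf _ (hpos k))
      (fun k => hC ⟨_, hpos k, rfl⟩) hW hX hindep
  · have hAS := hΓ.orderlyDivergenceAS_of_bddAbove hf ha hint hlam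
    exact ⟨hAS, hΓ.orderlyDivergence_of_orderlyDivergenceAS hf hint hAS⟩

theorem mainTheorem7 {Ω : Type*} [MeasurableSpace Ω] (μ : Measure Ω) [IsProbabilityMeasure μ]
    (f : ℝ → ℝ) (hf : ∀ x : ℝ, 0 < x → 0 ≤ f x) :
    (BddAbove (f '' Ioi 0) →
      Tendsto (totalWeight (sampledWeights f)) atTop atTop →
      ∀ X : ℕ → Ω → ℝ, iIndepFun X μ → (∀ k, HasLaw (X k) (expMeasure 1) μ) →
        WeightedDiscreteSLLN μ (sampledWeights f) X) ∧
    ((AntitoneOn f (Ioi 0) ∨ (MonotoneOn f (Ioi 0) ∧ BddAbove (f '' Ioi 0))) →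
      (∀ t : ℝ, IntegrableOn f (Ioc 0 t)) →
      Tendsto (lam f) atTop atTop →
      ∀ (Γ : ℝ≥0 → Ω → ℝ) (hΓ : IsGammaProcess Γ μ),
        OrderlyDivergenceAS hΓ f ∧ OrderlyDivergence hΓ f) := by
  obtain ⟨hdiscrete, hprocess⟩ := mainTheorem7_general μ f hf
  exact ⟨fun hbdd hW X hindep => hdiscrete hbdd hW X fun _ _ => hindep.indepFun,
    fun hmono => hprocess 1 (hmono.elim (bddAbove_image_Ioi_of_antitoneOn one_pos) fun hbdd =>
      hbdd.2.mono (image_mono (Ioi_subset_Ioi zero_le_one)))⟩
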